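/- Notation. For $M=(M_k)_{k\in\mathbb N}$ with all $M_k>0$, for $f\in C^\infty(\mathbb R,\mathbb R)$, $K\subseteq\mathbb R$ compact and $\rho>0$ put $$\|f\|^M_{K,\rho}=\sup\Big\{\frac{|f^{(k)}(x)|}{k!\,\rho^k M_k}: x\in K,\ k\in\mathbb N\Big\},$$ and let $\mathcal E^{(M)}(\mathbb R)$, respectively $\mathcal E^{\{M\}}(\mathbb R)$, be the space of all $f\in C^\infty(\mathbb R,\mathbb R)$ such that for every compact $K\subseteq\mathbb R$ one has $\|f\|^M_{K,\rho}<\infty$ for all $\rho>0$, respectively for some $\rho>0$. A weight function is a continuous increasing (that is, non-decreasing) function $\omega:[0,\infty)\to[0,\infty)$ with $\omega|_{[0,1]}=0$, $\lim_{t\to\infty}\omega(t)=\infty$, $\omega(2t)=O(\omega(t))$ and $\log t=o(\omega(t))$ as $t\to\infty$, and such that $\varphi(t)=\omega(e^t)$ is convex on $[0,\infty)$. With $\varphi^*(t)=\sup\{st-\varphi(s):s\ge0\}$ for $t\ge 0$, put $$\|f\|^\omega_{K,\rho}=\sup\big\{|f^{(k)}(x)|\exp(-\tfrac1\rho\varphi^*(\rho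 k)): x\in K,\ k\in\mathbb N\big\},$$ and define $\mathcal E^{(\omega)}(\mathbb R)$ and $\mathcal E^{\{\omega\}}(\mathbb R)$ as above, with $\|\cdot\|^\omega_{K,\rho}$ in place of $\|\cdot\|^M_{K,\rho}$. For the Gevrey weight matrix $\mathfrak G=\{G^s:s>0\}$, $G^s_k=(k!)^s$, let $\mathcal E^{(\mathfrak G)}(\mathbb R)=\bigcap_{s>0}\mathcal E^{(G^s)}(\mathbb R)$, and let $\mathcal E^{\{\mathfrak G\}}(\mathbb R)$ be the space of all $f\in C^\infty(\mathbb R,\mathbb R)$ such that for every compact $K\subseteq\mathbb R$ there are $s>0$ and $\rho>0$ with $\|f\|^{G^s}_{K,\rho}<\infty$. Theorem 5.22. Let $X$ be either of the spaces $\mathcal E^{(\mathfrak G)}(\mathbb R)$ and $\mathcal E^{\{\mathfrak G\}}(\mathbb R)$. Then, as linear subspaces of $C^\infty(\mathbb R,\mathbb R)$ (that is, as sets of functions), (1) for every sequence $M$ of positive real numbers, $X\neq\mathcal E^{(M)}(\mathbb R)$ and $X\neq\mathcal E^{\{M\}}(\mathbb R)$; (2) for every weight function $\omega$, $X\neq\mathcal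 E^{(\omega)}(\mathbb R)$ and $X\neq\mathcal E^{\{\omega\}}(\mathbb R)$. -/

import Mathlib

open Set Filter Asymptotics
open scoped Nat

/-! ### Classes defined by a weight sequence

All function spaces below are sets of smooth functions `ℝ → ℝ`; they are linear subspaces of
`C^∞(ℝ, ℝ)`, so two of them coincide as vector spaces exactly when they are equal as sets.
On `ℝ` the operator norm of the `k`-th Fréchet derivative is `|iteratedDeriv k f x|`. -/

/-- `‖f‖_{K,ρ}^M < ∞`, where
`‖f‖_{K,ρ}^M = sup { |f^{(k)}(x)| / (k! ρ^k M_k) : x ∈ K, k ∈ ℕ }`. -/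
def SeqNormFinite (M : ℕ → ℝ) (K : Set ℝ) (ρ : ℝ) (f : ℝ → ℝ) : Prop :=
  BddAbove {y : ℝ | ∃ x ∈ K, ∃ k : ℕ, y = |iteratedDeriv k f x| / ((k ! : ℝ) * ρ ^ k * M k)}

/-- The Beurling class `E^{(M)}(ℝ)`. -/
def beurlingSeq (M : ℕ → ℝ) : Set (ℝ → ℝ) :=
  {f | ContDiff ℝ (⊤ : ℕ∞) f ∧ ∀ K : Set ℝ, IsCompact K → ∀ ρ : ℝ, 0 < ρ → SeqNormFinite M K ρ f}

/-- The Roumieu class `E^{{M}}(ℝ)`. -/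
def roumieuSeq (M : ℕ → ℝ) : Set (ℝ → ℝ) :=
  {f | ContDiff ℝ (⊤ : ℕ∞) f ∧ ∀ K : Set ℝ, IsCompact K → ∃ ρ : ℝ, 0 < ρ ∧ SeqNormFinite M K ρ f}

/-! ### Classes defined by a family of weight sequences -/

/-- The Beurling class `E^{(𝔐)}(ℝ)`: the intersection of all `E^{(M^i)}(ℝ)`. -/
def beurlingMatrix {ι : Type*} (𝔐 : ι → ℕ → ℝ) : Set (ℝ → ℝ) :=
  {f | ContDiff ℝ (⊤ : ℕ∞) f ∧ ∀ i, f ∈ beurlingSeq (𝔐 i)}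

/-- The Roumieu class `E^{{𝔐}}(ℝ)`: the intersection over all compact `K` of the unions over `i`
of the classes `E^{{M^i}}(K)`. Both the index `i` and the radius `ρ` may depend on `K`. -/
def roumieuMatrix {ι : Type*} (𝔐 : ι → ℕ → ℝ) : Set (ℝ → ℝ) :=
  {f | ContDiff ℝ (⊤ : ℕ∞) f ∧
    ∀ K : Set ℝ, IsCompact K → ∃ i, ∃ ρ : ℝ, 0 < ρ ∧ SeqNormFinite (𝔐 i) K ρ f}

/-- The Gevrey weight matrix `𝔊 = {G^s : s > 0}`, `G^s_k = (k!)^s`. -/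
noncomputable def gevreyMatrix (s : Ioi (0 : ℝ)) (k : ℕ) : ℝ := (k ! : ℝ) ^ (s : ℝ)

/-! ### Classes defined by a weight function -/

/-- Weight functions `ω : [0, ∞) → [0, ∞)`; the values of `ω` at negative arguments are
irrelevant. -/
structure IsWeightFunction (ω : ℝ → ℝ) : Prop where
  continuousOn : ContinuousOn ω (Ici 0)
  monotoneOn : MonotoneOn ω (Ici 0)
  nonneg : ∀ t, 0 ≤ t → 0 ≤ ω t
  eq_zero : ∀ t ∈ Icc (0 : ℝ) 1, ω t = 0
  tendsto : Tendsto ω atTop atTop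
  /-- `ω(2t) = O(ω(t))` as `t → ∞` -/
  doubling : (fun t => ω (2 * t)) =O[atTop] ω
  /-- `log t = o(ω(t))` as `t → ∞` -/
  log_isLittleO : Real.log =o[atTop] ω
  /-- `t ↦ ω(e^t)` is convex on `[0, ∞)` -/
  convexOn : ConvexOn ℝ (Ici 0) (fun t => ω (Real.exp t))

/-- The Young conjugate `φ^*(t) = sup { s t - φ(s) : s ≥ 0 }` of `φ(s) = ω(e^s)`, for `t ≥ 0`.
For a weight function the set is bounded above, since `s = o(φ(s))` and `φ ≥ 0`. -/
noncomputable def youngConj (ω : ℝ → ℝ) (t : ℝ) : ℝ :=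
  sSup {y : ℝ | ∃ s : ℝ, 0 ≤ s ∧ y = s * t - ω (Real.exp s)}

/-- `‖f‖_{K,ρ}^ω < ∞`, where
`‖f‖_{K,ρ}^ω = sup { |f^{(k)}(x)| exp(- φ^*(ρ k) / ρ) : x ∈ K, k ∈ ℕ }`. -/
def FunNormFinite (ω : ℝ → ℝ) (K : Set ℝ) (ρ : ℝ) (f : ℝ → ℝ) : Prop :=
  BddAbove {y : ℝ | ∃ x ∈ K, ∃ k : ℕ,
    y = |iteratedDeriv k f x| * Real.exp (-(1 / ρ) * youngConj ω (ρ * k))}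

/-- The Beurling class `E^{(ω)}(ℝ)`. -/
def beurlingFun (ω : ℝ → ℝ) : Set (ℝ → ℝ) :=
  {f | ContDiff ℝ (⊤ : ℕ∞) f ∧ ∀ K : Set ℝ, IsCompact K → ∀ ρ : ℝ, 0 < ρ → FunNormFinite ω K ρ f}

/-- The Roumieu class `E^{{ω}}(ℝ)`. -/
def roumieuFun (ω : ℝ → ℝ) : Set (ℝ → ℝ) :=
  {f | ContDiff ℝ (⊤ : ℕ∞) f ∧ ∀ K : Set ℝ, IsCompact K → ∃ ρ : ℝ, 0 < ρ ∧ FunNormFinite ω K ρ f}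

/-! The functions `∑ aₙ (cos nx + sin nx)` with `aₙ ≥ 0` already separate the classes. Their `k`-th
derivative is bounded by twice the moment `∑ aₙ nᵏ` everywhere and equals the moment in absolute
value at `0`. Membership in any of the classes therefore says only that the moments are dominated by
suitable weights. Taking `aₙ = exp (-n^(1/p))` gives moments between any two Gevrey orders
(`exists_hasMoments_sandwich`).

For a class given by `M` or `ω`, the Gevrey order of the weights hardly depends on `ρ`
(`IsWeightSystem.transfer`), whereas the Gevrey matrix demands every order `s > 0` (Beurling) or
admits every order (Roumieu). Suppose the classes agree on these series. In the Beurling case of the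
matrix, a gliding hump (`exists_dominated_of_forall_mem`) forces some weight to dominate
`(k!)^(1+s)` with `s > 0`, so the other class contains a series of positive Gevrey order, a
contradiction. In the Roumieu case the weights dominate every Gevrey order, and a superposition of
series of growing order (`exists_not_dominated_of_forall_dominated`) stays in the other class but
has no finite order. -/

/-! ### Fourier series with non-negative, rapidly decreasing coefficients -/

/-- The `k`-th moment of the weights `a n` placed at the frequencies `n`. -/
noncomputable def moment (a : ℕ → ℝ) (k : ℕ) : ℝ := ∑' n, a n * (n : ℝ) ^ k

/-- Non-negative weights all of whose moments are finite. -/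
structure HasMoments (a : ℕ → ℝ) : Prop where
  nonneg : ∀ n, 0 ≤ a n
  summable : ∀ k : ℕ, Summable fun n => a n * (n : ℝ) ^ k

/-- The series `∑ aₙ nᵏ (cos + sin)(n x + k π / 2)`, which is the `k`-th derivative of
`∑ aₙ (cos (n x) + sin (n x))`. -/
noncomputable def fourierSum (a : ℕ → ℝ) (k : ℕ) (x : ℝ) : ℝ :=
  ∑' n, a n * (n : ℝ) ^ k *
    (Real.cos (n * x + k * (Real.pi / 2)) + Real.sin (n * x + k * (Real.pi / 2)))

theorem abs_cos_add_sin_le (y : ℝ) : |Real.cos y + Real.sin y| ≤ 2 := by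
  have h1 := Real.abs_cos_le_one y
  have h2 := Real.abs_sin_le_one y
  linarith [abs_add_le (Real.cos y) (Real.sin y)]

/-- `(cos y + sin y)² = 1 + sin 2y`. Thus, unlike for `cos` or `sin` alone, no derivative at `0`
loses its size. -/
theorem abs_cos_add_sin_nat_mul_pi_div_two (k : ℕ) :
    |Real.cos (k * (Real.pi / 2)) + Real.sin (k * (Real.pi / 2))| = 1 := by
  have h1 : Real.sin (2 * (k * (Real.pi / 2))) = 0 := by
    rw [show 2 * ((k : ℝ) * (Real.pi / 2)) = k * Real.pi by ring]
    exact Real.sin_nat_mul_pi k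
  rw [Real.sin_two_mul] at h1
  have h2 := Real.sin_sq_add_cos_sq (k * (Real.pi / 2))
  rw [← sq_eq_sq₀ (abs_nonneg _) zero_le_one, sq_abs]
  linear_combination h2 + h1

namespace HasMoments

variable {a : ℕ → ℝ}

theorem term_nonneg (ha : HasMoments a) (k n : ℕ) : 0 ≤ a n * (n : ℝ) ^ k :=
  mul_nonneg (ha.nonneg n) (by positivity)

theorem norm_term_le (ha : HasMoments a) (k n : ℕ) (y : ℝ) :
    ‖a n * (n : ℝ) ^ k * (Real.cos y + Real.sin y)‖ ≤ a n * (n : ℝ) ^ k * 2 := by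
  rw [norm_mul, Real.norm_of_nonneg (ha.term_nonneg k n)]
  exact mul_le_mul_of_nonneg_left (abs_cos_add_sin_le y) (ha.term_nonneg k n)

theorem hasDerivAt_fourierSum (ha : HasMoments a) (k : ℕ) (x : ℝ) :
    HasDerivAt (fourierSum a k) (fourierSum a (k + 1) x) x := by
  refine hasDerivAt_tsum (g' := fun n y => a n * (n : ℝ) ^ (k + 1) *
      (Real.cos (n * y + (k + 1 : ℕ) * (Real.pi / 2)) +
        Real.sin (n * y + (k + 1 : ℕ) * (Real.pi / 2)))) ((ha.summable (k + 1)).mul_right 2) (fun n y => ?_)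
    (fun n y => ha.norm_term_le (k + 1) n _) (y₀ := 0)
    (Summable.of_norm_bounded ((ha.summable k).mul_right 2) fun n => ha.norm_term_le k n _) x
  have h : HasDerivAt (fun z : ℝ => n * z + k * (Real.pi / 2)) n y := by
    simpa using ((hasDerivAt_id y).const_mul (n : ℝ)).add_const (k * (Real.pi / 2))
  have h' := (h.cos.add h.sin).const_mul (a n * (n : ℝ) ^ k)
  refine h'.congr_deriv ?_
  have e : (n : ℝ) * y + ((k + 1 : ℕ) : ℝ) * (Real.pi / 2)
      = (n * y + k * (Real.pi / 2)) + Real.pi / 2 := by push_cast; ring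
  rw [e, Real.cos_add_pi_div_two, Real.sin_add_pi_div_two]
  ring

theorem iteratedDeriv_fourierSum (ha : HasMoments a) (k : ℕ) :
    iteratedDeriv k (fourierSum a 0) = fourierSum a k := by
  induction k with
  | zero => exact iteratedDeriv_zero
  | succ k ih =>
    rw [iteratedDeriv_succ, ih]
    exact funext fun x => (ha.hasDerivAt_fourierSum k x).deriv

theorem contDiff_fourierSum (ha : HasMoments a) : ContDiff ℝ (⊤ : ℕ∞) (fourierSum a 0) := by
  refine contDiff_of_differentiable_iteratedDeriv fun k _ => ?_
  rw [ha.iteratedDeriv_fourierSum]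
  exact fun x => (ha.hasDerivAt_fourierSum k x).differentiableAt

theorem abs_iteratedDeriv_le (ha : HasMoments a) (k : ℕ) (x : ℝ) :
    |iteratedDeriv k (fourierSum a 0) x| ≤ 2 * moment a k := by
  rw [ha.iteratedDeriv_fourierSum, mul_comm, moment, ← tsum_mul_right]
  exact tsum_of_norm_bounded ((ha.summable k).mul_right 2).hasSum fun n => ha.norm_term_le k n _

theorem moment_nonneg (ha : HasMoments a) (k : ℕ) : 0 ≤ moment a k :=
  tsum_nonneg fun n => ha.term_nonneg k n

theorem abs_iteratedDeriv_zero (ha : HasMoments a) (k : ℕ) :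
    |iteratedDeriv k (fourierSum a 0) 0| = moment a k := by
  rw [ha.iteratedDeriv_fourierSum, fourierSum]
  simp only [mul_zero, zero_add]
  rw [tsum_mul_right, abs_mul, abs_cos_add_sin_nat_mul_pi_div_two, mul_one]
  exact abs_of_nonneg (ha.moment_nonneg k)

theorem term_le_moment (ha : HasMoments a) (k n : ℕ) : a n * (n : ℝ) ^ k ≤ moment a k :=
  (ha.summable k).le_tsum n fun m _ => ha.term_nonneg k m

theorem const_mul (ha : HasMoments a) {c : ℝ} (hc : 0 ≤ c) : HasMoments fun n => c * a n where
  nonneg n := mul_nonneg hc (ha.nonneg n)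
  summable k := by simpa only [mul_assoc] using (ha.summable k).mul_left c

end HasMoments

theorem moment_const_mul (a : ℕ → ℝ) (c : ℝ) (k : ℕ) :
    moment (fun n => c * a n) k = c * moment a k := by
  simp only [moment, mul_assoc, tsum_mul_left]

/-! ### Domination of sequences -/

/-- `u k ≤ C v k` for all `k`, with some constant `C`. -/
def Dominated (u v : ℕ → ℝ) : Prop := ∃ C : ℝ, 0 < C ∧ ∀ k, u k ≤ C * v k

theorem Dominated.trans {u v w : ℕ → ℝ} (h : Dominated u v) (h' : Dominated v w) :
    Dominated u w := by
  obtain ⟨C, hC, h⟩ := h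
  obtain ⟨D, hD, h'⟩ := h'
  refine ⟨C * D, by positivity, fun k => (h k).trans ?_⟩
  rw [mul_assoc]
  exact mul_le_mul_of_nonneg_left (h' k) hC.le

theorem Dominated.of_le {u v : ℕ → ℝ} (h : ∀ k, u k ≤ v k) : Dominated u v :=
  ⟨1, one_pos, by simpa using h⟩

/-- For weights `W`, the `W`-seminorm of `fourierSum a 0` on a set containing `0` is finite
exactly when the moments of `a` are dominated by `W`. -/
theorem HasMoments.bddAbove_iff {a : ℕ → ℝ} (ha : HasMoments a) {W : ℕ → ℝ} (hW : ∀ k, 0 < W k)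
    {K : Set ℝ} (hK : (0 : ℝ) ∈ K) :
    BddAbove {y : ℝ | ∃ x ∈ K, ∃ k : ℕ, y = |iteratedDeriv k (fourierSum a 0) x| / W k} ↔
      Dominated (moment a) W := by
  constructor
  · rintro ⟨B, hB⟩
    refine ⟨max B 1, by positivity, fun k => ?_⟩
    have h := hB ⟨0, hK, k, rfl⟩
    rw [ha.abs_iteratedDeriv_zero, div_le_iff₀ (hW k)] at h
    exact h.trans (mul_le_mul_of_nonneg_right (le_max_left _ _) (hW k).le)
  · rintro ⟨C, hC, h⟩
    refine ⟨2 * C, ?_⟩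
    rintro y ⟨x, -, k, rfl⟩
    rw [div_le_iff₀ (hW k)]
    linarith [ha.abs_iteratedDeriv_le k x, h k]

theorem HasMoments.bddAbove {a : ℕ → ℝ} (ha : HasMoments a) {W : ℕ → ℝ} (hW : ∀ k, 0 < W k)
    (h : Dominated (moment a) W) (K : Set ℝ) :
    BddAbove {y : ℝ | ∃ x ∈ K, ∃ k : ℕ, y = |iteratedDeriv k (fourierSum a 0) x| / W k} :=
  ((ha.bddAbove_iff hW (K := univ) (mem_univ 0)).2 h).mono (by
    rintro y ⟨x, -, k, hk⟩
    exact ⟨x, mem_univ x, k, hk⟩)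

/-! ### Superposition of countably many weights -/

/-- Against a fixed `u j`, the terms `i ≥ j` are summable by smallness and `u i ≤ u j`; the finitely
many others only need some constant. Non-negativity prevents cancellation, so the sum keeps every
lower bound. -/
theorem exists_superposition {A : ℕ → ℕ → ℝ} {u : ℕ → ℕ → ℝ} (hA : ∀ i, HasMoments (A i))
    (hu : ∀ i j, i ≤ j → ∀ k, u j k ≤ u i k)
    (hsmall : ∀ i k, moment (A i) k ≤ (1 / 2) ^ i * u i k)
    (hdom : ∀ i j, Dominated (moment (A i)) (u j)) :
    ∃ a, HasMoments a ∧ (∀ j, Dominated (moment a) (u j)) ∧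
      ∀ i k, moment (A i) k ≤ moment a k := by
  have key : ∀ j, ∃ c : ℕ → ℝ, (∀ i, 0 < c i) ∧ Summable c ∧
      ∀ i k, moment (A i) k ≤ c i * u j k := by
    intro j
    choose C hC h using fun i => hdom i j
    have hgeo : Summable fun i : ℕ => ((1 : ℝ) / 2) ^ i :=
      summable_geometric_of_lt_one (by norm_num) (by norm_num)
    refine ⟨fun i => if i < j then C i else (1 / 2) ^ i, fun i => ?_, ?_, fun i k => ?_⟩
    · dsimp only
      split_ifs
      · exact hC i
      · positivity
    · refine (summable_nat_add_iff j).1 ?_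
      simpa using (summable_nat_add_iff j).2 hgeo
    · dsimp only
      split_ifs with hij
      · exact h i k
      · exact (hsmall i k).trans
          (mul_le_mul_of_nonneg_left (hu j i (not_lt.1 hij) k) (by positivity))
  have hsum : ∀ k, Summable fun i => moment (A i) k := by
    intro k
    obtain ⟨c, -, hc, h⟩ := key 0
    exact Summable.of_nonneg_of_le (fun i => (hA i).moment_nonneg k) (fun i => h i k)
      (hc.mul_right _)
  have hprod : ∀ k : ℕ, Summable fun p : ℕ × ℕ => A p.1 p.2 * (p.2 : ℝ) ^ k := fun k =>
    (summable_prod_of_nonneg fun p => (hA p.1).term_nonneg k p.2).2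
      ⟨fun i => (hA i).summable k, hsum k⟩
  have hprod' : ∀ k : ℕ, Summable fun p : ℕ × ℕ => A p.2 p.1 * (p.1 : ℝ) ^ k := fun k =>
    (Equiv.prodComm ℕ ℕ).summable_iff.2 (hprod k)
  have ha : HasMoments fun n => ∑' i, A i n := by
    refine ⟨fun n => tsum_nonneg fun i => (hA i).nonneg n, fun k => ?_⟩
    simpa only [tsum_mul_right] using (hprod' k).prod
  have hm : ∀ k, moment (fun n => ∑' i, A i n) k = ∑' i, moment (A i) k := by
    intro k
    simp only [moment, ← tsum_mul_right]
    exact Summable.tsum_comm (hprod k)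
  refine ⟨_, ha, fun j => ?_, fun i k => ?_⟩
  · obtain ⟨c, hc0, hc, h⟩ := key j
    refine ⟨∑' i, c i, hc.tsum_pos (fun i => (hc0 i).le) 0 (hc0 0), fun k => ?_⟩
    rw [hm, ← tsum_mul_right]
    exact (hsum k).tsum_le_tsum (fun i => h i k) (hc.mul_right _)
  · rw [hm]
    exact (hsum k).le_tsum i fun j _ => (hA j).moment_nonneg k

/-! ### Gevrey growth -/

/-- The sequence `(k!)^{1 + s}`. -/
noncomputable def gevreyGrowth (s : ℝ) (k : ℕ) : ℝ := (k ! : ℝ) ^ (1 + s)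

theorem one_le_factorial_cast (k : ℕ) : (1 : ℝ) ≤ (k ! : ℝ) := by
  exact_mod_cast k.factorial_pos

theorem factorial_cast_pos (k : ℕ) : (0 : ℝ) < (k ! : ℝ) := by
  exact_mod_cast k.factorial_pos

theorem gevreyGrowth_pos (s : ℝ) (k : ℕ) : 0 < gevreyGrowth s k :=
  Real.rpow_pos_of_pos (factorial_cast_pos k) _

theorem gevreyGrowth_mono {s t : ℝ} (h : s ≤ t) (k : ℕ) : gevreyGrowth s k ≤ gevreyGrowth t k :=
  Real.rpow_le_rpow_of_exponent_le (one_le_factorial_cast k) (by linarith)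

theorem gevreyGrowth_add (s t : ℝ) (k : ℕ) :
    gevreyGrowth (s + t) k = gevreyGrowth s k * (k ! : ℝ) ^ t := by
  rw [gevreyGrowth, gevreyGrowth, ← Real.rpow_add (factorial_cast_pos k)]
  ring_nf

/-- The sequence `(B^(1/ε))ᵏ / k!` is bounded; raise the bound to the power `ε`. -/
theorem exists_pow_le_factorial_rpow {B ε : ℝ} (hB : 0 < B) (hε : 0 < ε) :
    ∃ C : ℝ, 0 < C ∧ ∀ k : ℕ, B ^ k ≤ C * (k ! : ℝ) ^ ε := by
  obtain ⟨D, hD⟩ :=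
    (FloorSemiring.tendsto_pow_div_factorial_atTop (B ^ ε⁻¹)).bddAbove_range
  have h0 : 0 < B ^ ε⁻¹ := Real.rpow_pos_of_pos hB _
  have hD1 : 1 ≤ D := by simpa using hD ⟨0, rfl⟩
  have hDpos : 0 < D := by linarith
  refine ⟨D ^ ε, Real.rpow_pos_of_pos hDpos _, fun k => ?_⟩
  have h : (B ^ ε⁻¹) ^ k ≤ D * k ! := (div_le_iff₀ (factorial_cast_pos k)).1 (hD ⟨k, rfl⟩)
  calc B ^ k = ((B ^ ε⁻¹) ^ k) ^ ε := by
        rw [← Real.rpow_natCast (B ^ ε⁻¹), ← Real.rpow_mul hB.le, ← Real.rpow_mul hB.le,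
          ← Real.rpow_natCast]
        congr 1
        field_simp
    _ ≤ (D * k !) ^ ε := Real.rpow_le_rpow (by positivity) h hε.le
    _ = D ^ ε * (k ! : ℝ) ^ ε := Real.mul_rpow hDpos.le (factorial_cast_pos k).le

/-- Geometric factors cost only an arbitrarily small increase of the exponent. -/
theorem dominated_pow_mul_gevreyGrowth {B s t : ℝ} (hB : 0 < B) (h : s < t) :
    Dominated (fun k => B ^ k * gevreyGrowth s k) (gevreyGrowth t) := by
  obtain ⟨C, hC, hk⟩ := exists_pow_le_factorial_rpow hB (sub_pos.2 h)
  refine ⟨C, hC, fun k => ?_⟩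
  rw [show t = s + (t - s) by ring, gevreyGrowth_add]
  calc B ^ k * gevreyGrowth s k ≤ (C * (k ! : ℝ) ^ (t - s)) * gevreyGrowth s k :=
        mul_le_mul_of_nonneg_right (hk k) (gevreyGrowth_pos s k).le
    _ = _ := by ring

theorem not_dominated_gevreyGrowth {s t : ℝ} (h : s < t) :
    ¬ Dominated (gevreyGrowth t) (gevreyGrowth s) := by
  rintro ⟨C, -, hC⟩
  have h1 : Tendsto (fun k : ℕ => (k ! : ℝ) ^ (t - s)) atTop atTop :=
    (tendsto_rpow_atTop (sub_pos.2 h)).comp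
      (tendsto_natCast_atTop_atTop.comp factorial_tendsto_atTop)
  obtain ⟨k, hk⟩ := (h1.eventually_gt_atTop C).exists
  have h2 := hC k
  rw [show t = s + (t - s) by ring, gevreyGrowth_add, mul_comm] at h2
  exact absurd (le_of_mul_le_mul_right h2 (gevreyGrowth_pos s k)) (not_le.2 hk)

/-! ### Weights whose moments have a prescribed Gevrey growth -/

/-- With `x = n^(1/p)`, raise `(x/p)ᵏ ≤ k! exp (x/p)` to the power `p`. -/
theorem pow_mul_exp_neg_rpow_le {p : ℝ} (hp : 0 < p) (n k : ℕ) :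
    (n : ℝ) ^ k * Real.exp (-(n : ℝ) ^ p⁻¹) ≤ (p ^ p) ^ k * (k ! : ℝ) ^ p := by
  set x : ℝ := (n : ℝ) ^ p⁻¹ with hx
  have hx0 : 0 ≤ x := by positivity
  have hxp : x ^ p = n := Real.rpow_inv_rpow (Nat.cast_nonneg n) hp.ne'
  have h : (x / p) ^ k ≤ Real.exp (x / p) * k ! :=
    (div_le_iff₀ (factorial_cast_pos k)).1
      (Real.pow_div_factorial_le_exp _ (div_nonneg hx0 hp.le) k)
  have h' := Real.rpow_le_rpow (by positivity) h hp.le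
  have e1 : ((x / p) ^ k) ^ p = (n : ℝ) ^ k / (p ^ p) ^ k := by
    rw [← Real.rpow_pow_comm (by positivity), Real.div_rpow hx0 hp.le, hxp, div_pow]
  rw [e1, Real.mul_rpow (Real.exp_pos _).le (factorial_cast_pos k).le, ← Real.exp_mul,
    div_mul_cancel₀ _ hp.ne', div_le_iff₀ (by positivity)] at h'
  calc (n : ℝ) ^ k * Real.exp (-x) ≤ (Real.exp x * (k ! : ℝ) ^ p * (p ^ p) ^ k) * Real.exp (-x) :=
        mul_le_mul_of_nonneg_right h' (Real.exp_pos _).le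
    _ = (p ^ p) ^ k * (k ! : ℝ) ^ p * (Real.exp x * Real.exp (-x)) := by ring
    _ = _ := by rw [← Real.exp_add]; simp

/-- `2 ^ k` bounds `(k + 1)`, so shifting the factorial by two costs only a geometric factor. -/
theorem factorial_add_two_le (k : ℕ) : ((k + 2)! : ℝ) ≤ 8 * 4 ^ k * k ! := by
  have h1 : (k : ℝ) + 1 ≤ 2 ^ k := by exact_mod_cast Nat.lt_two_pow_self (n := k)
  have h2 : (k : ℝ) + 2 ≤ 2 * 2 ^ k := by
    have : (1 : ℝ) ≤ 2 ^ k := one_le_pow₀ (by norm_num)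
    linarith
  have h4 : (4 : ℝ) ^ k = 2 ^ k * 2 ^ k := by rw [← mul_pow]; norm_num
  rw [Nat.factorial_succ, Nat.factorial_succ]
  push_cast
  rw [h4, ← mul_assoc]
  have h5 : ((k : ℝ) + 1 + 1) * (k + 1) ≤ 8 * (2 ^ k * 2 ^ k) := by
    have : ((k : ℝ) + 1 + 1) * (k + 1) ≤ (2 * 2 ^ k) * 2 ^ k :=
      mul_le_mul (by linarith) h1 (by positivity) (by positivity)
    nlinarith [show (0 : ℝ) < 2 ^ k * 2 ^ k by positivity]
  exact mul_le_mul_of_nonneg_right h5 (factorial_cast_pos k).le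

/-- Take `aₙ = exp (-n^(1/p))`, `p = 1 + r`, `s < r < t`. The termwise bound at `k + 2` supplies a
summable `n⁻²` for the upper estimate; the single term `n ≈ k^p` gives the lower one. Both are sharp
up to geometric factors, absorbed by the gaps around `r`. -/
theorem exists_hasMoments_sandwich {s t : ℝ} (hs : 0 ≤ s) (hst : s < t) :
    ∃ a, HasMoments a ∧ Dominated (gevreyGrowth s) (moment a) ∧
      Dominated (moment a) (gevreyGrowth t) := by
  obtain ⟨r, hsr, hrt⟩ := exists_between hst
  set p : ℝ := 1 + r with hp
  have hp1 : 1 ≤ p := by linarith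
  have hp0 : 0 < p := by linarith
  set a : ℕ → ℝ := fun n => Real.exp (-(n : ℝ) ^ p⁻¹) with ha
  have hinv : Summable fun n : ℕ => ((n : ℝ) ^ 2)⁻¹ := Real.summable_nat_pow_inv.2 one_lt_two
  have hterm : ∀ k n : ℕ, n ≠ 0 →
      a n * (n : ℝ) ^ k ≤ (p ^ p) ^ (k + 2) * ((k + 2)! : ℝ) ^ p * ((n : ℝ) ^ 2)⁻¹ := by
    intro k n hn
    have hn' : (0 : ℝ) < (n : ℝ) ^ 2 := by positivity
    rw [← div_eq_mul_inv, le_div_iff₀ hn']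
    have := pow_mul_exp_neg_rpow_le hp0 n (k + 2)
    rw [pow_add] at this
    linarith
  -- Since `(0²)⁻¹ = 0` by convention, the indicator carries the term `n = 0`, which equals `1` when
  -- `k = 0`.
  have hterm' : ∀ k n : ℕ, a n * (n : ℝ) ^ k ≤
      (if n = 0 then 1 else 0) +
        (p ^ p) ^ (k + 2) * ((k + 2)! : ℝ) ^ p * ((n : ℝ) ^ 2)⁻¹ := by
    intro k n
    rcases eq_or_ne n 0 with rfl | hn
    · have h0 : a 0 * ((0 : ℕ) : ℝ) ^ k ≤ 1 := by
        have : a 0 ≤ 1 := by simp [ha, Real.zero_rpow (inv_ne_zero hp0.ne')]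
        refine mul_le_one₀ this (by positivity) ?_
        rw [Nat.cast_zero]
        exact pow_le_one₀ le_rfl zero_le_one
      simpa using h0
    · simpa [hn] using hterm k n hn
  have hdelta : HasSum (fun n : ℕ => if n = 0 then (1 : ℝ) else 0) 1 := hasSum_ite_eq 0 1
  have hbound : ∀ k : ℕ, HasSum (fun n : ℕ => (if n = 0 then (1 : ℝ) else 0) +
        (p ^ p) ^ (k + 2) * ((k + 2)! : ℝ) ^ p * ((n : ℝ) ^ 2)⁻¹)
      (1 + (p ^ p) ^ (k + 2) * ((k + 2)! : ℝ) ^ p * ∑' n : ℕ, ((n : ℝ) ^ 2)⁻¹) := fun k =>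
    hdelta.add (hinv.hasSum.mul_left _)
  have hm : HasMoments a := by
    refine ⟨fun n => (Real.exp_pos _).le, fun k => ?_⟩
    exact Summable.of_nonneg_of_le (fun n => mul_nonneg (Real.exp_pos _).le (by positivity))
      (hterm' k) (hbound k).summable
  refine ⟨a, hm, ?_, ?_⟩
  · obtain ⟨C, hC, hk⟩ := dominated_pow_mul_gevreyGrowth (Real.exp_pos 1) hsr
    refine ⟨C * Real.exp 1, by positivity, fun k => ?_⟩
    have hle : gevreyGrowth r k ≤ Real.exp 1 ^ (k + 1) * moment a k := by
      -- Rounding up keeps `nᵏ ≥ (kᵏ)^p`, while `k^p + 1 ≤ (k + 1)^p` keeps `n^(1/p) ≤ k + 1`.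
      set n : ℕ := ⌈(k : ℝ) ^ p⌉₊ with hn
      have hn1 : (k : ℝ) ^ p ≤ n := Nat.le_ceil _
      have hn2 : (n : ℝ) ≤ ((k : ℝ) + 1) ^ p := by
        have h1 : (n : ℝ) < (k : ℝ) ^ p + 1 := Nat.ceil_lt_add_one (by positivity)
        have h2 := Real.add_rpow_le_rpow_add (Nat.cast_nonneg k) zero_le_one hp1
        rw [Real.one_rpow] at h2
        linarith
      have hn3 : (n : ℝ) ^ p⁻¹ ≤ k + 1 :=
        (Real.rpow_inv_le_iff_of_pos (by positivity) (by positivity) hp0).2 hn2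
      have hfac : gevreyGrowth r k ≤ (n : ℝ) ^ k := by
        calc gevreyGrowth r k ≤ ((k : ℝ) ^ k) ^ p :=
              Real.rpow_le_rpow (factorial_cast_pos k).le
                (by exact_mod_cast Nat.factorial_le_pow k) hp0.le
          _ = ((k : ℝ) ^ p) ^ k := by rw [← Real.rpow_pow_comm (Nat.cast_nonneg k)]
          _ ≤ (n : ℝ) ^ k := pow_le_pow_left₀ (by positivity) hn1 k
      have hexp : 1 ≤ Real.exp 1 ^ (k + 1) * a n := by
        rw [ha, ← Real.exp_nat_mul, ← Real.exp_add, Real.one_le_exp_iff]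
        push_cast
        linarith
      calc gevreyGrowth r k ≤ 1 * (n : ℝ) ^ k := by rwa [one_mul]
        _ ≤ (Real.exp 1 ^ (k + 1) * a n) * (n : ℝ) ^ k :=
            mul_le_mul_of_nonneg_right hexp (by positivity)
        _ = Real.exp 1 ^ (k + 1) * (a n * (n : ℝ) ^ k) := by ring
        _ ≤ _ := mul_le_mul_of_nonneg_left (hm.term_le_moment k n) (by positivity)
    refine le_of_mul_le_mul_left ?_ (show (0 : ℝ) < Real.exp 1 ^ k by positivity)
    calc Real.exp 1 ^ k * gevreyGrowth s k ≤ C * gevreyGrowth r k := hk k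
      _ ≤ C * (Real.exp 1 ^ (k + 1) * moment a k) := mul_le_mul_of_nonneg_left hle hC.le
      _ = _ := by ring
  · have hQ : 1 ≤ p ^ p := Real.one_le_rpow hp1 hp0.le
    set S : ℝ := ∑' n : ℕ, ((n : ℝ) ^ 2)⁻¹ with hS
    have hS0 : 0 ≤ S := tsum_nonneg fun n => by positivity
    have h4 : (1 : ℝ) ≤ 4 ^ p := Real.one_le_rpow (by norm_num) hp0.le
    refine Dominated.trans (v := fun k => (p ^ p * 4 ^ p) ^ k * gevreyGrowth r k)
      ⟨1 + (p ^ p) ^ 2 * 8 ^ p * S, by positivity, fun k => ?_⟩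
      (dominated_pow_mul_gevreyGrowth (by positivity) hrt)
    have hfac : ((k + 2)! : ℝ) ^ p ≤ 8 ^ p * (4 ^ p) ^ k * gevreyGrowth r k := by
      have := Real.rpow_le_rpow (factorial_cast_pos _).le (factorial_add_two_le k) hp0.le
      rwa [Real.mul_rpow (by positivity) (factorial_cast_pos k).le,
        Real.mul_rpow (by positivity) (by positivity),
        ← Real.rpow_pow_comm (by norm_num : (0 : ℝ) ≤ 4)] at this
    have hone : 1 ≤ (p ^ p * 4 ^ p) ^ k * gevreyGrowth r k :=
      one_le_mul_of_one_le_of_one_le (one_le_pow₀ (one_le_mul_of_one_le_of_one_le hQ h4))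
        (Real.one_le_rpow (one_le_factorial_cast k) hp0.le)
    calc moment a k ≤ 1 + (p ^ p) ^ (k + 2) * ((k + 2)! : ℝ) ^ p * S := by
          rw [← (hbound k).tsum_eq]
          exact (hm.summable k).tsum_le_tsum (hterm' k) (hbound k).summable
      _ ≤ (p ^ p * 4 ^ p) ^ k * gevreyGrowth r k +
          (p ^ p) ^ (k + 2) * (8 ^ p * (4 ^ p) ^ k * gevreyGrowth r k) * S := by gcongr
      _ = _ := by ring

/-! ### Diagonal arguments -/

/-- If the moments of `b` exceed `v` at some place then so do those of a finite truncation. -/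
theorem HasMoments.exists_truncation {b : ℕ → ℝ} (hb : HasMoments b) {v : ℕ → ℝ} {k : ℕ}
    (hk : v k < moment b k) :
    ∃ a, HasMoments a ∧ (∀ j, moment a j ≤ moment b j) ∧ v k < moment a k ∧
      ∃ C B : ℝ, 0 < C ∧ 0 < B ∧ ∀ j, moment a j ≤ C * B ^ j := by
  obtain ⟨N, hN⟩ := ((hb.summable k).hasSum.tendsto_sum_nat.eventually_const_lt hk).exists
  set a : ℕ → ℝ := fun n => if n < N then b n else 0 with ha
  have hsupp : ∀ j n : ℕ, n ∉ Finset.range N → a n * (n : ℝ) ^ j = 0 := by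
    intro j n hn
    simp [ha, Finset.mem_range.not.1 hn]
  have hmom : ∀ j, moment a j = ∑ n ∈ Finset.range N, b n * (n : ℝ) ^ j := by
    intro j
    rw [moment, tsum_eq_sum (hsupp j)]
    exact Finset.sum_congr rfl fun n hn => by simp [ha, Finset.mem_range.1 hn]
  refine ⟨a, ⟨fun n => ?_, fun j => summable_of_ne_finset_zero (hsupp j)⟩, fun j => ?_, ?_,
    -- The added ones keep both constants positive when the truncation is zero or empty.
    ∑ n ∈ Finset.range N, b n + 1, N + 1, ?_, by positivity, fun j => ?_⟩
  · change 0 ≤ if n < N then b n else 0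
    split_ifs
    exacts [hb.nonneg n, le_rfl]
  · rw [hmom]
    exact (hb.summable j).sum_le_tsum _ fun n _ => hb.term_nonneg j n
  · rwa [hmom]
  · have := Finset.sum_nonneg fun n (_ : n ∈ Finset.range N) => hb.nonneg n
    linarith
  · rw [hmom, add_mul, Finset.sum_mul]
    refine le_add_of_le_of_nonneg (Finset.sum_le_sum fun n hn => ?_) (by positivity)
    have hnN : (n : ℝ) ≤ N + 1 := by exact_mod_cast (Finset.mem_range.1 hn).le.trans N.le_succ
    exact mul_le_mul_of_nonneg_left (pow_le_pow_left₀ (Nat.cast_nonneg n) hnN j) (hb.nonneg n)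

/-- Gliding hump: otherwise, for each `i`, a small multiple of a series of order at most `1/(i+1)`
exceeds `i V i` somewhere. A truncation still does so, and its geometric moments are below every
Gevrey order. The superposition then satisfies the hypothesis of `h` but is dominated by no `V i`.
-/
theorem exists_dominated_of_forall_mem {V : ℕ → ℕ → ℝ} (hV : ∀ i k, 0 < V i k)
    (hmono : ∀ i j, i ≤ j → ∀ k, V i k ≤ V j k)
    (h : ∀ a, HasMoments a → (∀ s, 0 < s → Dominated (moment a) (gevreyGrowth s)) →
      ∃ i, Dominated (moment a) (V i)) :
    ∃ i s, 0 < s ∧ Dominated (gevreyGrowth s) (V i) := by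
  by_contra! hcon
  have key : ∀ i : ℕ, ∃ a, HasMoments a ∧
      (∀ k, moment a k ≤ (1 / 2) ^ i * gevreyGrowth (1 / ((i : ℝ) + 1)) k) ∧
      (∀ s, 0 < s → Dominated (moment a) (gevreyGrowth s)) ∧
      ∃ k, (i : ℝ) * V i k < moment a k := by
    intro i
    set t : ℝ := 1 / ((i : ℝ) + 1) with ht
    have ht0 : 0 < t := by positivity
    obtain ⟨b, hb, hlow, C, hC, hup⟩ :=
      exists_hasMoments_sandwich (half_pos ht0).le (half_lt_self ht0)
    set c : ℝ := (1 / 2) ^ i / C with hc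
    have hc0 : 0 < c := by positivity
    have hcb := hb.const_mul hc0.le
    have hex : ∃ k, (i : ℝ) * V i k < moment (fun n => c * b n) k := by
      by_contra! hle
      -- The factor `i + 1` instead of `i` keeps the constant positive for `i = 0`.
      refine hcon i (t / 2) (half_pos ht0) (hlow.trans ⟨((i : ℝ) + 1) / c, by positivity, fun k => ?_⟩)
      have h1 := hle k
      rw [moment_const_mul] at h1
      rw [div_mul_eq_mul_div, le_div_iff₀ hc0]
      nlinarith [hV i k]
    obtain ⟨k, hk⟩ := hex
    obtain ⟨a, ha, hab, hak, D, B, hD, hB, hDB⟩ :=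
      hcb.exists_truncation (v := fun k => (i : ℝ) * V i k) hk
    refine ⟨a, ha, fun j => (hab j).trans ?_, fun s hs => ?_, k, hak⟩
    · rw [moment_const_mul]
      calc c * moment b j ≤ c * (C * gevreyGrowth t j) :=
            mul_le_mul_of_nonneg_left (hup j) hc0.le
        _ = _ := by rw [hc]; field_simp
    · refine Dominated.trans ⟨D, hD, fun j => (hDB j).trans ?_⟩
        (dominated_pow_mul_gevreyGrowth hB hs (s := 0))
      refine mul_le_mul_of_nonneg_left (le_mul_of_one_le_right (by positivity) ?_) hD.le
      exact Real.one_le_rpow (one_le_factorial_cast j) (by norm_num)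
  choose A hA hsmall hdom K hK using key
  obtain ⟨a, ha, hdoma, hle⟩ := exists_superposition (A := A)
    (u := fun i => gevreyGrowth (1 / ((i : ℝ) + 1))) hA
    (fun i j hij k => gevreyGrowth_mono (by gcongr) k) hsmall
    (fun i j => hdom i _ (by positivity))
  obtain ⟨i, C, hC, hi⟩ := h a ha fun s hs => by
    obtain ⟨n, hn⟩ := exists_nat_one_div_lt hs
    exact (hdoma n).trans (Dominated.of_le fun k => gevreyGrowth_mono hn.le k)
  obtain ⟨m, hm⟩ := exists_nat_ge C
  -- The hump of index `j` refutes the bound by `C * V i`, as `j ≥ C` and `V j ≥ V i`.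
  set j := max i m with hj
  have h1 : (j : ℝ) * V j (K j) < C * V i (K j) := (hK j).trans_le ((hle j _).trans (hi _))
  have h2 : C ≤ j := hm.trans (by exact_mod_cast le_max_right i m)
  have h3 : C * V i (K j) ≤ j * V j (K j) :=
    mul_le_mul h2 (hmono i j (le_max_left i m) _) (hV i _).le (by positivity)
  linarith

/-- Superpose scaled series of order between `i` and `i + 1`. No truncation is needed, since every
Gevrey order lies below every `V j`. -/
theorem exists_not_dominated_of_forall_dominated {V : ℕ → ℕ → ℝ}
    (hanti : ∀ i j, i ≤ j → ∀ k, V j k ≤ V i k)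
    (h : ∀ s, 0 < s → ∀ i, Dominated (gevreyGrowth s) (V i)) :
    ∃ a, HasMoments a ∧ (∀ i, Dominated (moment a) (V i)) ∧
      ∀ s, ¬ Dominated (moment a) (gevreyGrowth s) := by
  have key : ∀ i : ℕ, ∃ a, HasMoments a ∧ (∀ k, moment a k ≤ (1 / 2) ^ i * V i k) ∧
      (∀ j, Dominated (moment a) (V j)) ∧ Dominated (gevreyGrowth i) (moment a) := by
    intro i
    obtain ⟨b, hb, hlow, hup⟩ :=
      exists_hasMoments_sandwich (Nat.cast_nonneg i) (lt_add_one (i : ℝ))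
    have hupV : ∀ j, Dominated (moment b) (V j) := fun j => hup.trans (h _ (by positivity) j)
    obtain ⟨C, hC, hCk⟩ := hupV i
    set c : ℝ := (1 / 2) ^ i / C with hc
    have hc0 : 0 < c := by positivity
    refine ⟨_, hb.const_mul hc0.le, fun k => ?_, fun j => ?_, hlow.trans ?_⟩
    · rw [moment_const_mul]
      calc c * moment b k ≤ c * (C * V i k) := mul_le_mul_of_nonneg_left (hCk k) hc0.le
        _ = _ := by rw [hc]; field_simp
    · exact Dominated.trans ⟨c, hc0, fun k => (moment_const_mul b c k).le⟩ (hupV j)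
    · refine ⟨c⁻¹, by positivity, fun k => ?_⟩
      rw [moment_const_mul, inv_mul_cancel_left₀ hc0.ne']
  choose A hA hsmall hdom hlow using key
  obtain ⟨a, ha, hdoma, hle⟩ := exists_superposition hA hanti hsmall hdom
  refine ⟨a, ha, hdoma, fun s hs => ?_⟩
  obtain ⟨i, hi⟩ := exists_nat_gt s
  exact not_dominated_gevreyGrowth hi (((hlow i).trans (Dominated.of_le (hle i))).trans hs)

/-! ### Weight systems -/

/-- The properties of the weights `W ρ`, `ρ > 0`, defining a Beurling or Roumieu class that
distinguish such a class from the Gevrey ones: Gevrey growth of the weights hardly depends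
on the parameter `ρ`. -/
structure IsWeightSystem (W : ℝ → ℕ → ℝ) : Prop where
  pos : ∀ ρ, 0 < ρ → ∀ k, 0 < W ρ k
  mono : ∀ ρ σ, 0 < ρ → ρ ≤ σ → ∀ k, W ρ k ≤ W σ k
  transfer : ∀ s t, 0 < s → s < t → ∀ ρ σ, 0 < ρ → 0 < σ →
    Dominated (gevreyGrowth t) (W ρ) → Dominated (gevreyGrowth s) (W σ)

/-- The moments of `a` satisfy the bounds of the Beurling class given by `W`. -/
def BeurlingBound (W : ℝ → ℕ → ℝ) (a : ℕ → ℝ) : Prop := ∀ ρ, 0 < ρ → Dominated (moment a) (W ρ)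

/-- The moments of `a` satisfy the bounds of the Roumieu class given by `W`. -/
def RoumieuBound (W : ℝ → ℕ → ℝ) (a : ℕ → ℝ) : Prop := ∃ ρ, 0 < ρ ∧ Dominated (moment a) (W ρ)

namespace IsWeightSystem

variable {W : ℝ → ℕ → ℝ}

/-- The single weight `W 1` already dominates a positive order; `transfer` spreads this to all `ρ`.
-/
theorem exists_beurlingGevrey_beurling_ne (hW : IsWeightSystem W) :
    ∃ a, HasMoments a ∧ ¬ (BeurlingBound gevreyGrowth a ↔ BeurlingBound W a) := by
  by_contra! hcon
  obtain ⟨-, s, hs, hd⟩ := exists_dominated_of_forall_mem (V := fun _ => W 1)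
    (fun _ => hW.pos 1 one_pos) (fun _ _ _ _ => le_rfl)
    fun a ha h => ⟨0, (hcon a ha).1 h 1 one_pos⟩
  obtain ⟨a, ha, hlow, hup⟩ :=
    exists_hasMoments_sandwich (s := s / 4) (t := s / 2) (by positivity) (by linarith)
  have hmem := (hcon a ha).2 fun ρ hρ =>
    hup.trans (hW.transfer _ s (by positivity) (by linarith) 1 ρ one_pos hρ hd)
  exact not_dominated_gevreyGrowth (by linarith : s / 8 < s / 4)
    (hlow.trans (hmem (s / 8) (by positivity)))

/-- The weights `W (i + 1)` exhaust the union over `ρ`, and one weight of positive order suffices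
for Roumieu membership. -/
theorem exists_beurlingGevrey_roumieu_ne (hW : IsWeightSystem W) :
    ∃ a, HasMoments a ∧ ¬ (BeurlingBound gevreyGrowth a ↔ RoumieuBound W a) := by
  by_contra! hcon
  obtain ⟨i, s, hs, hd⟩ := exists_dominated_of_forall_mem (V := fun i : ℕ => W (i + 1))
    (fun i => hW.pos _ (by positivity)) (fun i j hij => hW.mono _ _ (by positivity) (by gcongr))
    fun a ha h => by
      obtain ⟨ρ, hρ, hd⟩ := (hcon a ha).1 h
      obtain ⟨i, hi⟩ := exists_nat_ge ρ
      exact ⟨i, hd.trans (Dominated.of_le (hW.mono _ _ hρ (by linarith)))⟩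
  obtain ⟨a, ha, hlow, hup⟩ :=
    exists_hasMoments_sandwich (s := s / 2) (t := s) (by positivity) (by linarith)
  have hmem := (hcon a ha).2 ⟨(i : ℝ) + 1, by positivity, hup.trans hd⟩
  exact not_dominated_gevreyGrowth (by linarith : s / 4 < s / 2)
    (hlow.trans (hmem (s / 4) (by positivity)))

theorem exists_roumieuGevrey_beurling_ne (hW : IsWeightSystem W) :
    ∃ a, HasMoments a ∧ ¬ (RoumieuBound gevreyGrowth a ↔ BeurlingBound W a) := by
  by_contra! hcon
  obtain ⟨a, ha, hd, hn⟩ := exists_not_dominated_of_forall_dominated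
    (V := fun i : ℕ => W (1 / ((i : ℝ) + 1)))
    (fun i j hij => hW.mono _ _ (by positivity) (by gcongr)) fun s hs i => by
      obtain ⟨a, ha, hlow, hup⟩ := exists_hasMoments_sandwich hs.le (lt_add_one s)
      exact hlow.trans ((hcon a ha).1 ⟨s + 1, by linarith, hup⟩ _ (by positivity))
  obtain ⟨s, -, h⟩ := (hcon a ha).2 fun ρ hρ => by
    obtain ⟨n, hn⟩ := exists_nat_one_div_lt hρ
    exact (hd n).trans (Dominated.of_le (hW.mono _ _ (by positivity) hn.le))
  exact hn s h

/-- The radius obtained for order `s + 1` may depend on `s`; `transfer` moves all of them to `ρ = 1`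
at the cost of one order. -/
theorem exists_roumieuGevrey_roumieu_ne (hW : IsWeightSystem W) :
    ∃ a, HasMoments a ∧ ¬ (RoumieuBound gevreyGrowth a ↔ RoumieuBound W a) := by
  by_contra! hcon
  obtain ⟨a, ha, hd, hn⟩ := exists_not_dominated_of_forall_dominated (V := fun _ => W 1)
    (fun _ _ _ _ => le_rfl) fun s hs _ => by
      obtain ⟨a, ha, hlow, hup⟩ := exists_hasMoments_sandwich (s := s + 1) (by linarith)
        (lt_add_one (s + 1))
      obtain ⟨ρ, hρ, hd⟩ := (hcon a ha).1 ⟨s + 1 + 1, by linarith, hup⟩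
      exact hW.transfer s (s + 1) hs (lt_add_one s) ρ 1 hρ one_pos (hlow.trans hd)
  obtain ⟨s, -, h⟩ := (hcon a ha).2 ⟨1, one_pos, hd 0⟩
  exact hn s h

end IsWeightSystem

/-! ### The weight system of a weight sequence -/

/-- The weights `k! ρᵏ Mₖ`. -/
noncomputable def seqWeight (M : ℕ → ℝ) (ρ : ℝ) (k : ℕ) : ℝ := (k ! : ℝ) * ρ ^ k * M k

theorem isWeightSystem_seqWeight {M : ℕ → ℝ} (hM : ∀ k, 0 < M k) :
    IsWeightSystem (seqWeight M) where
  pos ρ hρ k := mul_pos (mul_pos (factorial_cast_pos k) (by positivity)) (hM k)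
  mono ρ σ hρ h k := by
    have := (hM k).le
    unfold seqWeight
    gcongr
  -- Passing from `ρ` to `σ` changes the weights by a geometric factor, absorbed by `t - s`.
  transfer s t hs hst ρ σ hρ hσ h := by
    obtain ⟨C, hC, hk⟩ := dominated_pow_mul_gevreyGrowth (div_pos hρ hσ) hst
    obtain ⟨D, hD, hk'⟩ := h
    refine ⟨C * D, by positivity, fun k => ?_⟩
    refine le_of_mul_le_mul_left ?_ (show 0 < (ρ / σ) ^ k by positivity)
    calc (ρ / σ) ^ k * gevreyGrowth s k ≤ C * (D * seqWeight M ρ k) :=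
          (hk k).trans (mul_le_mul_of_nonneg_left (hk' k) hC.le)
      _ = _ := by
          rw [seqWeight, seqWeight, div_pow]
          field_simp

/-! ### The weight system of a weight function -/

namespace IsWeightFunction

variable {ω : ℝ → ℝ}

theorem bddAbove_youngConj (hω : IsWeightFunction ω) {t : ℝ} (ht : 0 ≤ t) :
    BddAbove {y : ℝ | ∃ s : ℝ, 0 ≤ s ∧ y = s * t - ω (Real.exp s)} := by
  -- Eventually `(t + 1) s ≤ ω (e^s)`, so only `s ≤ |N|` can give positive values.
  have hpos : 0 < (t + 1)⁻¹ := by positivity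
  have h := (hω.log_isLittleO.def hpos).and (eventually_ge_atTop 1)
  obtain ⟨N, hN⟩ := eventually_atTop.1 h
  refine ⟨|N| * t, ?_⟩
  rintro y ⟨s, hs, rfl⟩
  have hω0 := hω.nonneg _ (Real.exp_pos s).le
  rcases le_total s |N| with hsN | hsN
  · nlinarith
  · have h1 := (hN (Real.exp s) (by linarith [le_abs_self N, Real.add_one_le_exp s])).1
    rw [Real.log_exp, Real.norm_of_nonneg hs, Real.norm_of_nonneg hω0, inv_mul_eq_div,
      le_div_iff₀ (by positivity)] at h1
    nlinarith [mul_nonneg (abs_nonneg N) ht]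

theorem youngConj_mono (hω : IsWeightFunction ω) {t u : ℝ} (ht : 0 ≤ t) (h : t ≤ u) :
    youngConj ω t ≤ youngConj ω u := by
  refine csSup_le ⟨_, 0, le_rfl, rfl⟩ ?_
  rintro y ⟨s, hs, rfl⟩
  refine le_trans ?_ (le_csSup (hω.bddAbove_youngConj (ht.trans h)) ⟨s, hs, rfl⟩)
  nlinarith

/-- As `ω ≥ 0` and `c ≤ 1`, `s c t - φ(s) ≤ c (s t - φ(s))` for each `s`. This makes `φ^*(ρk)/ρ`
monotone in `ρ`. -/
theorem youngConj_mul_le (hω : IsWeightFunction ω) {c t : ℝ} (hc : 0 ≤ c) (hc1 : c ≤ 1)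
    (ht : 0 ≤ t) : youngConj ω (c * t) ≤ c * youngConj ω t := by
  refine csSup_le ⟨_, 0, le_rfl, rfl⟩ ?_
  rintro y ⟨s, hs, rfl⟩
  have h := le_csSup (hω.bddAbove_youngConj ht) ⟨s, hs, rfl⟩
  have hω0 := hω.nonneg _ (Real.exp_pos s).le
  refine le_trans ?_ (mul_le_mul_of_nonneg_left h hc)
  nlinarith

end IsWeightFunction

/-- The weights `exp (φ^*(ρ k) / ρ)`. -/
noncomputable def funWeight (ω : ℝ → ℝ) (ρ : ℝ) (k : ℕ) : ℝ :=
  Real.exp (1 / ρ * youngConj ω (ρ * k))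

theorem funWeight_mono {ω : ℝ → ℝ} (hω : IsWeightFunction ω) {ρ σ : ℝ} (hρ : 0 < ρ) (h : ρ ≤ σ)
    (k : ℕ) : funWeight ω ρ k ≤ funWeight ω σ k := by
  have hσ : 0 < σ := hρ.trans_le h
  have h1 := hω.youngConj_mul_le (c := ρ / σ) (t := σ * k) (by positivity)
    ((div_le_one hσ).2 h) (by positivity)
  rw [show ρ / σ * (σ * k) = ρ * k by field_simp] at h1
  refine Real.exp_le_exp.2 ?_
  calc 1 / ρ * youngConj ω (ρ * k) ≤ 1 / ρ * (ρ / σ * youngConj ω (σ * k)) := by gcongr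
    _ = _ := by field_simp

/-- `W_ρ(⌊k / N⌋) ^ N ≤ W_{ρ / N}(k)`. -/
theorem funWeight_div_pow_le {ω : ℝ → ℝ} (hω : IsWeightFunction ω) {ρ : ℝ} (hρ : 0 < ρ) {N : ℕ}
    (hN : 0 < N) (k : ℕ) : funWeight ω ρ (k / N) ^ N ≤ funWeight ω (ρ / N) k := by
  have hN' : (0 : ℝ) < N := by exact_mod_cast hN
  rw [funWeight, ← Real.exp_nat_mul, funWeight, Real.exp_le_exp]
  have h1 : ρ * ((k / N : ℕ) : ℝ) ≤ ρ / N * k := by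
    rw [div_mul_eq_mul_div, mul_div_assoc]
    exact mul_le_mul_of_nonneg_left Nat.cast_div_le hρ.le
  have h2 := hω.youngConj_mono (by positivity) h1
  calc (N : ℝ) * (1 / ρ * youngConj ω (ρ * ((k / N : ℕ) : ℝ)))
      ≤ N * (1 / ρ * youngConj ω (ρ / N * k)) := by gcongr
    _ = _ := by field_simp

/-- `k! ≤ (D^{j+1} j!)^N` for `j = ⌊k / N⌋` and some `D`. -/
theorem exists_factorial_le_pow {N : ℕ} (hN : 0 < N) :
    ∃ D : ℝ, 1 ≤ D ∧ ∀ k : ℕ, (k ! : ℝ) ≤ (D ^ (k / N + 1) * ((k / N)! : ℝ)) ^ N := by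
  have hN1 : (1 : ℝ) ≤ N := by exact_mod_cast hN
  refine ⟨2 * Real.exp 1 * N, ?_, fun k => ?_⟩
  · nlinarith [Real.add_one_le_exp (1 : ℝ)]
  set j := k / N with hj
  have hk : k ≤ N * (j + 1) := (Nat.lt_mul_div_succ k hN).le
  have hpow : ((j + 1 : ℕ) : ℝ) ^ (j + 1) ≤ Real.exp 1 ^ (j + 1) * ((j + 1)! : ℝ) := by
    have := Real.pow_div_factorial_le_exp ((j + 1 : ℕ) : ℝ) (Nat.cast_nonneg _) (j + 1)
    rwa [div_le_iff₀ (factorial_cast_pos _), ← Real.exp_one_pow] at this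
  have hsucc : ((j + 1)! : ℝ) ≤ 2 ^ (j + 1) * (j ! : ℝ) := by
    rw [Nat.factorial_succ, Nat.cast_mul]
    refine mul_le_mul_of_nonneg_right ?_ (Nat.cast_nonneg _)
    exact_mod_cast Nat.lt_two_pow_self.le
  calc (k ! : ℝ) ≤ ((N * (j + 1))! : ℝ) := by exact_mod_cast Nat.factorial_le hk
    _ ≤ ((N * (j + 1) : ℕ) : ℝ) ^ (N * (j + 1)) := by
        exact_mod_cast Nat.factorial_le_pow (N * (j + 1))
    _ = ((N : ℝ) ^ (j + 1) * ((j + 1 : ℕ) : ℝ) ^ (j + 1)) ^ N := by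
        rw [Nat.cast_mul, ← mul_pow, mul_comm N (j + 1), pow_mul]
    _ ≤ ((N : ℝ) ^ (j + 1) * (Real.exp 1 ^ (j + 1) * (2 ^ (j + 1) * (j ! : ℝ)))) ^ N := by
        refine pow_le_pow_left₀ (by positivity) (mul_le_mul_of_nonneg_left ?_ (by positivity)) N
        exact hpow.trans (mul_le_mul_of_nonneg_left hsucc (by positivity))
    _ = _ := by
        congr 1
        rw [mul_pow, mul_pow]
        ring

theorem isWeightSystem_funWeight {ω : ℝ → ℝ} (hω : IsWeightFunction ω) :
    IsWeightSystem (funWeight ω) where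
  pos ρ _ k := Real.exp_pos _
  mono ρ σ hρ h k := funWeight_mono hω hρ h k
  -- Choose `N` with `ρ/N ≤ σ` and put `j = ⌊k/N⌋`. Up to geometric factors in `j`, absorbed by `t -
  -- s`, `k!` is at most `(j!)^N`; the hypothesis at `j`, raised to the power `N`, passes to
  -- `W_{ρ/N}(k)`.
  transfer s t hs hst ρ σ hρ hσ h := by
    obtain ⟨N, hN⟩ := exists_nat_gt (ρ / σ)
    have hN0 : (0 : ℝ) < N := lt_trans (by positivity) hN
    have hNpos : 0 < N := by exact_mod_cast hN0
    have hle : ρ / N ≤ σ := by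
      rw [div_lt_iff₀ hσ] at hN
      rw [div_le_iff₀ hN0]
      linarith
    refine Dominated.trans ?_ (Dominated.of_le (funWeight_mono hω (by positivity) hle))
    obtain ⟨D, hD, hfac⟩ := exists_factorial_le_pow hNpos
    have hD0 : 0 < D := by linarith
    obtain ⟨C, hC, hk⟩ := (dominated_pow_mul_gevreyGrowth
      (B := D ^ (1 + s)) (Real.rpow_pos_of_pos hD0 _) hst).trans h
    refine ⟨(D ^ (1 + s) * C) ^ N, by positivity, fun k => ?_⟩
    set j := k / N with hj
    have h1s : 0 ≤ 1 + s := by linarith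
    calc gevreyGrowth s k ≤ ((D ^ (j + 1) * (j ! : ℝ)) ^ N) ^ (1 + s) :=
          Real.rpow_le_rpow (factorial_cast_pos k).le (hfac k) h1s
      _ = (D ^ (1 + s) * ((D ^ (1 + s)) ^ j * gevreyGrowth s j)) ^ N := by
          rw [← Real.rpow_pow_comm (by positivity), Real.mul_rpow (by positivity) (by positivity),
            ← Real.rpow_pow_comm hD0.le, gevreyGrowth]
          ring
      _ ≤ (D ^ (1 + s) * (C * funWeight ω ρ j)) ^ N :=
          pow_le_pow_left₀ (mul_nonneg (by positivity)
            (mul_nonneg (by positivity) (gevreyGrowth_pos s j).le))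
            (mul_le_mul_of_nonneg_left (hk j) (by positivity)) N
      _ = (D ^ (1 + s) * C) ^ N * funWeight ω ρ j ^ N := by rw [← mul_assoc, mul_pow]
      _ ≤ _ := mul_le_mul_of_nonneg_left (funWeight_div_pow_le hω hρ hNpos k) (by positivity)

/-! ### Membership of the Fourier series in the function classes -/

namespace HasMoments

variable {a : ℕ → ℝ}

/-- Testing on `K = {0}` recovers the moments, and moment bounds control all of `ℝ` at once. -/
theorem mem_beurlingSeq_iff (ha : HasMoments a) {M : ℕ → ℝ} (hM : ∀ k, 0 < M k) :
    fourierSum a 0 ∈ beurlingSeq M ↔ BeurlingBound (seqWeight M) a := by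
  have hpos := (isWeightSystem_seqWeight hM).pos
  constructor
  · rintro ⟨-, h⟩ ρ hρ
    exact (ha.bddAbove_iff (hpos ρ hρ) (mem_singleton 0)).1 (h {0} isCompact_singleton ρ hρ)
  · exact fun h => ⟨ha.contDiff_fourierSum, fun K _ ρ hρ => ha.bddAbove (hpos ρ hρ) (h ρ hρ) K⟩

theorem mem_roumieuSeq_iff (ha : HasMoments a) {M : ℕ → ℝ} (hM : ∀ k, 0 < M k) :
    fourierSum a 0 ∈ roumieuSeq M ↔ RoumieuBound (seqWeight M) a := by
  have hpos := (isWeightSystem_seqWeight hM).pos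
  constructor
  · rintro ⟨-, h⟩
    obtain ⟨ρ, hρ, h⟩ := h {0} isCompact_singleton
    exact ⟨ρ, hρ, (ha.bddAbove_iff (hpos ρ hρ) (mem_singleton 0)).1 h⟩
  · rintro ⟨ρ, hρ, h⟩
    exact ⟨ha.contDiff_fourierSum, fun K _ => ⟨ρ, hρ, ha.bddAbove (hpos ρ hρ) h K⟩⟩

theorem funNormFinite_iff (f : ℝ → ℝ) (ω : ℝ → ℝ) (K : Set ℝ) (ρ : ℝ) :
    FunNormFinite ω K ρ f ↔
      BddAbove {y : ℝ | ∃ x ∈ K, ∃ k : ℕ, y = |iteratedDeriv k f x| / funWeight ω ρ k} := by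
  simp only [FunNormFinite, funWeight, neg_mul, Real.exp_neg, div_eq_mul_inv]

theorem mem_beurlingFun_iff (ha : HasMoments a) {ω : ℝ → ℝ} :
    fourierSum a 0 ∈ beurlingFun ω ↔ BeurlingBound (funWeight ω) a := by
  have hpos : ∀ ρ k, 0 < funWeight ω ρ k := fun _ _ => Real.exp_pos _
  constructor
  · rintro ⟨-, h⟩ ρ hρ
    exact (ha.bddAbove_iff (hpos ρ) (mem_singleton 0)).1
      ((funNormFinite_iff _ _ _ _).1 (h {0} isCompact_singleton ρ hρ))
  · exact fun h => ⟨ha.contDiff_fourierSum, fun K _ ρ hρ =>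
      (funNormFinite_iff _ _ _ _).2 (ha.bddAbove (hpos ρ) (h ρ hρ) K)⟩

theorem mem_roumieuFun_iff (ha : HasMoments a) {ω : ℝ → ℝ} :
    fourierSum a 0 ∈ roumieuFun ω ↔ RoumieuBound (funWeight ω) a := by
  have hpos : ∀ ρ k, 0 < funWeight ω ρ k := fun _ _ => Real.exp_pos _
  constructor
  · rintro ⟨-, h⟩
    obtain ⟨ρ, hρ, h⟩ := h {0} isCompact_singleton
    exact ⟨ρ, hρ, (ha.bddAbove_iff (hpos ρ) (mem_singleton 0)).1
      ((funNormFinite_iff _ _ _ _).1 h)⟩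
  · rintro ⟨ρ, hρ, h⟩
    exact ⟨ha.contDiff_fourierSum, fun K _ =>
      ⟨ρ, hρ, (funNormFinite_iff _ _ _ _).2 (ha.bddAbove (hpos ρ) h K)⟩⟩

end HasMoments

theorem gevreyMatrix_pos (s : Ioi (0 : ℝ)) (k : ℕ) : 0 < gevreyMatrix s k :=
  Real.rpow_pos_of_pos (factorial_cast_pos k) _

theorem seqWeight_gevreyMatrix (s : Ioi (0 : ℝ)) (ρ : ℝ) (k : ℕ) :
    seqWeight (gevreyMatrix s) ρ k = ρ ^ k * gevreyGrowth s k := by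
  rw [seqWeight, gevreyMatrix, gevreyGrowth, Real.rpow_add (factorial_cast_pos k), Real.rpow_one]
  ring

theorem dominated_seqWeight_gevreyMatrix {s : ℝ} {t : Ioi (0 : ℝ)} (hst : s < t) {ρ : ℝ}
    (hρ : 0 < ρ) : Dominated (gevreyGrowth s) (seqWeight (gevreyMatrix t) ρ) := by
  obtain ⟨C, hC, h⟩ := dominated_pow_mul_gevreyGrowth (inv_pos.2 hρ) hst
  refine ⟨C, hC, fun k => ?_⟩
  have h1 := mul_le_mul_of_nonneg_left (h k) (show 0 ≤ ρ ^ k by positivity)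
  rw [← mul_assoc, ← mul_pow, mul_inv_cancel₀ hρ.ne', one_pow, one_mul] at h1
  rw [seqWeight_gevreyMatrix]
  linarith

namespace HasMoments

variable {a : ℕ → ℝ}

theorem mem_beurlingMatrix_iff (ha : HasMoments a) :
    fourierSum a 0 ∈ beurlingMatrix gevreyMatrix ↔ BeurlingBound gevreyGrowth a := by
  constructor
  · rintro ⟨-, h⟩ s hs
    refine ((ha.mem_beurlingSeq_iff (gevreyMatrix_pos ⟨s, hs⟩)).1 (h ⟨s, hs⟩) 1 one_pos).trans
      (Dominated.of_le fun k => ?_)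
    simp [seqWeight_gevreyMatrix]
  · refine fun h => ⟨ha.contDiff_fourierSum, fun s =>
      (ha.mem_beurlingSeq_iff (gevreyMatrix_pos s)).2 fun ρ hρ => ?_⟩
    have hs : (0 : ℝ) < s := s.2
    exact (h (s / 2) (half_pos hs)).trans (dominated_seqWeight_gevreyMatrix (half_lt_self hs) hρ)

theorem mem_roumieuMatrix_iff (ha : HasMoments a) :
    fourierSum a 0 ∈ roumieuMatrix gevreyMatrix ↔ RoumieuBound gevreyGrowth a := by
  have hpos : ∀ (s : Ioi (0 : ℝ)) (ρ : ℝ), 0 < ρ → ∀ k, 0 < seqWeight (gevreyMatrix s) ρ k :=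
    fun s => (isWeightSystem_seqWeight (gevreyMatrix_pos s)).pos
  constructor
  · rintro ⟨-, h⟩
    obtain ⟨s, ρ, hρ, h⟩ := h {0} isCompact_singleton
    have hs : (0 : ℝ) < s := s.2
    refine ⟨s + 1, by linarith, ((ha.bddAbove_iff (hpos s ρ hρ) (mem_singleton 0)).1 h).trans ?_⟩
    exact (Dominated.of_le fun k => (seqWeight_gevreyMatrix s ρ k).le).trans
      (dominated_pow_mul_gevreyGrowth hρ (lt_add_one (s : ℝ)))
  · rintro ⟨s, hs, h⟩
    refine ⟨ha.contDiff_fourierSum, fun K _ => ⟨⟨s, hs⟩, 1, one_pos, ?_⟩⟩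
    refine ha.bddAbove (hpos _ 1 one_pos) (h.trans (Dominated.of_le fun k => ?_)) K
    simp [seqWeight_gevreyMatrix]

end HasMoments

theorem ne_of_exists_hasMoments {X Y : Set (ℝ → ℝ)} {P Q : (ℕ → ℝ) → Prop}
    (hX : ∀ a, HasMoments a → (fourierSum a 0 ∈ X ↔ P a))
    (hY : ∀ a, HasMoments a → (fourierSum a 0 ∈ Y ↔ Q a))
    (h : ∃ a, HasMoments a ∧ ¬ (P a ↔ Q a)) : X ≠ Y := by
  rintro rfl
  obtain ⟨a, ha, hne⟩ := h
  exact hne ((hX a ha).symm.trans (hY a ha))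

theorem theorem5p22 :
    (∀ M : ℕ → ℝ, (∀ k, 0 < M k) →
      beurlingMatrix gevreyMatrix ≠ beurlingSeq M ∧
      beurlingMatrix gevreyMatrix ≠ roumieuSeq M ∧
      roumieuMatrix gevreyMatrix ≠ beurlingSeq M ∧
      roumieuMatrix gevreyMatrix ≠ roumieuSeq M) ∧
    (∀ ω : ℝ → ℝ, IsWeightFunction ω →
      beurlingMatrix gevreyMatrix ≠ beurlingFun ω ∧
      beurlingMatrix gevreyMatrix ≠ roumieuFun ω ∧
      roumieuMatrix gevreyMatrix ≠ beurlingFun ω ∧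
      roumieuMatrix gevreyMatrix ≠ roumieuFun ω) := by
  have hB := fun a (ha : HasMoments a) => ha.mem_beurlingMatrix_iff
  have hR := fun a (ha : HasMoments a) => ha.mem_roumieuMatrix_iff
  refine ⟨fun M hM => ?_, fun ω hω => ?_⟩
  · have hW := isWeightSystem_seqWeight hM
    have hb := fun a (ha : HasMoments a) => ha.mem_beurlingSeq_iff hM
    have hr := fun a (ha : HasMoments a) => ha.mem_roumieuSeq_iff hM
    exact ⟨ne_of_exists_hasMoments hB hb hW.exists_beurlingGevrey_beurling_ne,
      ne_of_exists_hasMoments hB hr hW.exists_beurlingGevrey_roumieu_ne,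
      ne_of_exists_hasMoments hR hb hW.exists_roumieuGevrey_beurling_ne,
      ne_of_exists_hasMoments hR hr hW.exists_roumieuGevrey_roumieu_ne⟩
  · have hW := isWeightSystem_funWeight hω
    have hb := fun a (ha : HasMoments a) => ha.mem_beurlingFun_iff (ω := ω)
    have hr := fun a (ha : HasMoments a) => ha.mem_roumieuFun_iff (ω := ω)
    exact ⟨ne_of_exists_hasMoments hB hb hW.exists_beurlingGevrey_beurling_ne,
      ne_of_exists_hasMoments hB hr hW.exists_beurlingGevrey_roumieu_ne,
      ne_of_exists_hasMoments hR hb hW.exists_roumieuGevrey_beurling_ne,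
      ne_of_exists_hasMoments hR hr hW.exists_roumieuGevrey_roumieu_ne⟩
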